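/- **Conventions.** All subcategories are full and closed under isomorphisms; for a functor $F$ and a subcategory $\mathcal X$, $F\mathcal X$ denotes the closure under isomorphisms of $\{FX : X\in\mathcal X\}$. Let $(\mathscr C,\mathbb E,\mathfrak s)$ be an extriangulated category in the sense of Nakaoka and Palu: $\mathscr C$ is an additive category, $\mathbb E:\mathscr C^{op}\times\mathscr C\to Ab$ a biadditive functor, and $\mathfrak s$ an additive realization of $\mathbb E$, which assigns to every $\delta\in\mathbb E(C,A)$ an equivalence class of sequences $A\to B\to C$, such that (ET3), (ET3)$^{op}$, (ET4), (ET4)$^{op}$ hold. A sequence $A\xrightarrow{x}B\xrightarrow{y}C$ in the class $\mathfrak s(\delta)$ of some $\delta$ is a *conflation*, $x$ is an *inflation* and $y$ a *deflation*. A morphism $\delta\to\delta'$ of extensions, $\delta\in\mathbb E(C,A)$, $\delta'\in\mathbb E(C',A')$, is a pair $(a:A\to A',\,c:C\to C')$ with $a_*\delta=c^*\delta'$. All extriangulated categories below satisfy condition (WIC): if $gf$ is an inflation, then so is $f$; if $gf$ is a deflation, then so is $g$. *Projectives.* $P$ is projective if every morphism from $P$ to $C$ factors through $y$ for every conflation $A\to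 B\xrightarrow{y}C$; $\mathscr C$ has enough projectives if every $M$ admits a conflation $A\to P\to M$ with $P$ projective. Injectives are defined dually. $\mathscr C$ is Frobenius if it has enough projectives and enough injectives and the projectives are exactly the injectives. *Exactness.* A morphism is *compatible* if it is an isomorphism whenever it is both an inflation and a deflation. A sequence $A\xrightarrow{f}B\xrightarrow{g}C$ is *right exact* if $f=h_2h_1$ with $h_1:A\to K$ a compatible deflation and $K\xrightarrow{h_2}B\xrightarrow{g}C$ a conflation; *left exact* is the dual notion. A $4$-term $\mathbb E$-triangle sequence $A\xrightarrow{f}B\xrightarrow{g}C\xrightarrow{h}D$, that is, $g=g_2g_1$ with conflations $A\xrightarrow{f}B\xrightarrow{g_1}K$ and $K\xrightarrow{g_2}C\xrightarrow{h}D$, is *right exact* (resp. *left exact*) if these can be chosen with $g_1$ (resp. $g_2$) compatible. An additive functor $F:\mathcal A\to\mathcal B$ between extriangulated categories is *exact* if it preserves compatible morphisms and there is a natural transformation $\eta:\mathbb E_{\mathcal A}(-,-)\Rightarrow\mathbb E_{\mathcal B}(F-,F-)$ such that $\mathfrak s_{\mathcal A}(\delta)=[A\xrightarrow{x}B\xrightarrow{y}C]$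 implies $\mathfrak s_{\mathcal B}(\eta(\delta))=[FA\xrightarrow{Fx}FB\xrightarrow{Fy}FC]$. It is *right exact* if it preserves compatible morphisms and right exact sequences, and one can attach to every $\delta\in\mathbb E_{\mathcal A}(C,A)$ an object $A'_\delta$, a compatible deflation $p_\delta:FA\to A'_\delta$ and an extension $\eta(\delta)\in\mathbb E_{\mathcal B}(FC,A'_\delta)$ such that - for $\mathfrak s_{\mathcal A}(\delta)=[A\xrightarrow{f}B\xrightarrow{g}C]$ there is $x:A'_\delta\to FB$ with $Ff=x\,p_\delta$ and $\mathfrak s_{\mathcal B}(\eta(\delta))=[A'_\delta\xrightarrow{x}FB\xrightarrow{Fg}FC]$, and - for every morphism of extensions $(a,c):\delta\to\delta'$ there is $k:A'_\delta\to A'_{\delta'}$ with $k\,p_\delta=p_{\delta'}\,F(a)$ such that $(k,Fc)$ is a morphism $\eta(\delta)\to\eta(\delta')$. *Left exact* functors are defined dually. *Recollements.* A recollement $(\mathcal A,\mathcal B,\mathcal C)$ of extriangulated categories consists of exact functors $i_*:\mathcal A\to\mathcal B$, $j^*:\mathcal B\to\mathcal C$, right exact functors $i^*:\mathcal B\to\mathcal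 A$, $j_!:\mathcal C\to\mathcal B$ and left exact functors $i^!:\mathcal B\to\mathcal A$, $j_*:\mathcal C\to\mathcal B$ such that - (R1) $(i^*,i_*,i^!)$ and $(j_!,j^*,j_*)$ are adjoint triples; - (R2) the essential image of $i_*$ is $\operatorname{Ker}j^*$; - (R3) $i_*,j_!,j_*$ are fully faithful; - (R4) for each $X\in\mathcal B$ there is a left exact $4$-term $\mathbb E_{\mathcal B}$-triangle sequence $i_*i^!X\to X\to j_*j^*X\to i_*A$ with $A\in\mathcal A$; - (R5) for each $X\in\mathcal B$ there is a right exact $4$-term $\mathbb E_{\mathcal B}$-triangle sequence $i_*A'\to j_!j^*X\to X\to i_*i^*X$ with $A'\in\mathcal A$; where in (R4) and (R5) the maps $i_*i^!X\to X\to j_*j^*X$ and $j_!j^*X\to X\to i_*i^*X$ are the adjunction morphisms. *Cotorsion pairs.* A pair $(\mathcal T,\mathcal F)$ of subcategories of $\mathscr C$ is a cotorsion pair in $\mathscr C$ if (a) $\mathbb E(\mathcal T,\mathcal F)=0$; (b) every $C\in\mathscr C$ admits a conflation $F\to T\to C$ with $F\in\mathcal F$, $T\in\mathcal T$; (c) every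 $C\in\mathscr C$ admits a conflation $C\to F'\to T'$ with $F'\in\mathcal F$, $T'\in\mathcal T$. For a subcategory $\mathcal X$ put $\mathcal X^{\perp_1}=\{M\in\mathscr C:\mathbb E(\mathcal X,M)=0\}$. **Theorem.** Let $(\mathcal A,\mathcal B,\mathcal C)$ be a recollement of extriangulated categories, all three satisfying (WIC). Assume that $\mathcal B$ has enough projectives and that $i^!$ and $j_!$ are exact. (1) Let $(\mathcal T_1,\mathcal F_1)$ and $(\mathcal T_2,\mathcal F_2)$ be cotorsion pairs in $\mathcal A$ and $\mathcal C$, and put $$\mathcal T=\{B\in\mathcal B: i^*B\in\mathcal T_1,\ j^*B\in\mathcal T_2\},\qquad \mathcal F=\{B\in\mathcal B: i^!B\in\mathcal F_1,\ j^*B\in\mathcal F_2\}.$$ If one of the following conditions holds, then $(\mathcal T,\mathcal F)$ is a cotorsion pair in $\mathcal B$: - (i) $\mathbb E_{\mathcal B}(\mathcal T,\mathcal F)=0$; - (ii) $i^*$ is exact; - (iii) for every morphism $f:i_*A\to j_!T$ with $A\in\mathcal A$ and $T\in\mathcal T_2$, the map $f^*:\mathcal B(j_!T,F)\to\mathcal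 B(i_*A,F)$ is surjective for all $F\in\mathcal F$; - (iv) $\mathcal T\subseteq j_!\mathcal T_2$ or $i_*\mathcal F_1\subseteq\mathcal T^{\perp_1}$; - (v) $\mathcal A$ and $\mathcal B$ are Frobenius. (2) If $(\mathcal U,\mathcal V)$ is a cotorsion pair in $\mathcal B$ with $i_*i^!\mathcal U\subseteq\mathcal U$ and $i_*i^*\mathcal U\subseteq\mathcal U$, then $(i^*\mathcal U,i^!\mathcal V)$ is a cotorsion pair in $\mathcal A$. (3) If $(\mathcal U,\mathcal V)$ is a cotorsion pair in $\mathcal B$ with $j_*j^*\mathcal V\subseteq\mathcal V$ or $j_!j^*\mathcal U\subseteq\mathcal U$, then $(j^*\mathcal U,j^*\mathcal V)$ is a cotorsion pair in $\mathcal C$. -/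

import Mathlib

open CategoryTheory CategoryTheory.Limits Opposite

universe w w₁ w₂ w₃ v v₁ v₂ v₃ u u₁ u₂ u₃

namespace Extri

/-! ### Extensions -/

section Extensions

variable {𝒞 : Type u} [Category.{v} 𝒞]

/-- The group `𝔼(C, A)` of extensions. -/
abbrev Ext (E : 𝒞ᵒᵖ ⥤ 𝒞 ⥤ AddCommGrpCat.{w}) (C A : 𝒞) : Type w :=
  (E.obj (op C)).obj A

/-- The map `a_* : 𝔼(C, A) → 𝔼(C, A')` induced by `a : A ⟶ A'`. -/
def push (E : 𝒞ᵒᵖ ⥤ 𝒞 ⥤ AddCommGrpCat.{w}) {C A A' : 𝒞} (a : A ⟶ A') :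
    Ext E C A →+ Ext E C A' :=
  ((E.obj (op C)).map a).hom

/-- The map `c^* : 𝔼(C, A) → 𝔼(C', A)` induced by `c : C' ⟶ C`. -/
def pull (E : 𝒞ᵒᵖ ⥤ 𝒞 ⥤ AddCommGrpCat.{w}) {C C' A : 𝒞} (c : C' ⟶ C) :
    Ext E C A →+ Ext E C' A :=
  ((E.map c.op).app A).hom

/-- `(a, c)` is a morphism of extensions `δ ⟶ δ'`, that is, `a_* δ = c^* δ'`. -/
def IsExtMor (E : 𝒞ᵒᵖ ⥤ 𝒞 ⥤ AddCommGrpCat.{w}) {A C A' C' : 𝒞} (δ : Ext E C A)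
    (δ' : Ext E C' A') (a : A ⟶ A') (c : C ⟶ C') : Prop :=
  push E a δ = pull E c δ'

/-- The extension `δ ⊕ δ' ∈ 𝔼(C ⊕ C', A ⊕ A')`, whose components in the four groups
`𝔼(C, A)`, `𝔼(C, A')`, `𝔼(C', A)`, `𝔼(C', A')` are `δ, 0, 0, δ'`. -/
noncomputable def extSum [Preadditive 𝒞] [HasBinaryBiproducts 𝒞]
    (E : 𝒞ᵒᵖ ⥤ 𝒞 ⥤ AddCommGrpCat.{w}) {A C A' C' : 𝒞}
    (δ : Ext E C A) (δ' : Ext E C' A') : Ext E (C ⊞ C') (A ⊞ A') :=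
  push E biprod.inl (pull E biprod.fst δ) + push E biprod.inr (pull E biprod.snd δ')

/-- Equivalence of sequences `A ⟶ B ⟶ C` and `A ⟶ B' ⟶ C` with the same end terms. -/
def SeqEquiv {A B B' C : 𝒞} (x : A ⟶ B) (y : B ⟶ C) (x' : A ⟶ B') (y' : B' ⟶ C) : Prop :=
  ∃ b : B ≅ B', x ≫ b.hom = x' ∧ b.hom ≫ y' = y

end Extensions

/-! ### Extriangulated categories -/

/-- An extriangulated structure on an additive category. The correspondence `𝔰` sending an
extension `δ` to an equivalence class of sequences `A ⟶ B ⟶ C` is encoded by the relation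
`Realizes δ x y`, meaning `𝔰(δ) = [x, y]`: the first three fields about it say that the
sequences related to a given `δ` form exactly one equivalence class. -/
structure ExtriangulatedStructure (𝒞 : Type u) [Category.{v} 𝒞] [Preadditive 𝒞]
    [HasZeroObject 𝒞] [HasBinaryBiproducts 𝒞] where
  E : 𝒞ᵒᵖ ⥤ 𝒞 ⥤ AddCommGrpCat.{w}
  additive_left : E.Additive
  additive_right : ∀ X : 𝒞ᵒᵖ, (E.obj X).Additive
  Realizes : ∀ {A B C : 𝒞}, Ext E C A → (A ⟶ B) → (B ⟶ C) → Prop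
  exists_realizes : ∀ {A C : 𝒞} (δ : Ext E C A),
    ∃ (B : 𝒞) (x : A ⟶ B) (y : B ⟶ C), Realizes δ x y
  realizes_of_seqEquiv : ∀ {A B B' C : 𝒞} {δ : Ext E C A} {x : A ⟶ B} {y : B ⟶ C}
    {x' : A ⟶ B'} {y' : B' ⟶ C}, Realizes δ x y → SeqEquiv x y x' y' → Realizes δ x' y'
  seqEquiv_of_realizes : ∀ {A B B' C : 𝒞} {δ : Ext E C A} {x : A ⟶ B} {y : B ⟶ C}
    {x' : A ⟶ B'} {y' : B' ⟶ C}, Realizes δ x y → Realizes δ x' y' → SeqEquiv x y x' y'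
  /-- Every morphism of extensions is realized by a morphism of sequences. -/
  exists_middle : ∀ {A B C A' B' C' : 𝒞} {δ : Ext E C A} {δ' : Ext E C' A'}
    {x : A ⟶ B} {y : B ⟶ C} {x' : A' ⟶ B'} {y' : B' ⟶ C'} {a : A ⟶ A'} {c : C ⟶ C'},
    Realizes δ x y → Realizes δ' x' y' → IsExtMor E δ δ' a c →
    ∃ b : B ⟶ B', x ≫ b = a ≫ x' ∧ y ≫ c = b ≫ y'
  realizes_zero : ∀ A C : 𝒞,
    Realizes (0 : Ext E C A) (biprod.inl : A ⟶ A ⊞ C) (biprod.snd : A ⊞ C ⟶ C)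
  realizes_sum : ∀ {A B C A' B' C' : 𝒞} {δ : Ext E C A} {δ' : Ext E C' A'}
    {x : A ⟶ B} {y : B ⟶ C} {x' : A' ⟶ B'} {y' : B' ⟶ C'},
    Realizes δ x y → Realizes δ' x' y' →
    Realizes (extSum E δ δ') (biprod.map x x') (biprod.map y y')
  /-- (ET3) -/
  et3 : ∀ {A B C A' B' C' : 𝒞} {δ : Ext E C A} {δ' : Ext E C' A'}
    {x : A ⟶ B} {y : B ⟶ C} {x' : A' ⟶ B'} {y' : B' ⟶ C'} {a : A ⟶ A'} {b : B ⟶ B'},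
    Realizes δ x y → Realizes δ' x' y' → x ≫ b = a ≫ x' →
    ∃ c : C ⟶ C', y ≫ c = b ≫ y' ∧ IsExtMor E δ δ' a c
  /-- (ET3)ᵒᵖ -/
  et3_op : ∀ {A B C A' B' C' : 𝒞} {δ : Ext E C A} {δ' : Ext E C' A'}
    {x : A ⟶ B} {y : B ⟶ C} {x' : A' ⟶ B'} {y' : B' ⟶ C'} {b : B ⟶ B'} {c : C ⟶ C'},
    Realizes δ x y → Realizes δ' x' y' → y ≫ c = b ≫ y' →
    ∃ a : A ⟶ A', x ≫ b = a ≫ x' ∧ IsExtMor E δ δ' a c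
  /-- (ET4) -/
  et4 : ∀ {A B C D F : 𝒞} {δ : Ext E D A} {δ' : Ext E F B}
    {f : A ⟶ B} {f' : B ⟶ D} {g : B ⟶ C} {g' : C ⟶ F},
    Realizes δ f f' → Realizes δ' g g' →
    ∃ (G : 𝒞) (d : D ⟶ G) (e : G ⟶ F) (h : A ⟶ C) (h' : C ⟶ G) (δ'' : Ext E G A),
      f ≫ g = h ∧ f' ≫ d = g ≫ h' ∧ h' ≫ e = g' ∧ Realizes δ'' h h' ∧
      Realizes (push E f' δ') d e ∧ pull E d δ'' = δ ∧ push E f δ'' = pull E e δ'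
  /-- (ET4)ᵒᵖ -/
  et4_op : ∀ {A B C D F : 𝒞} {δ : Ext E B D} {δ' : Ext E C F}
    {f' : D ⟶ A} {f : A ⟶ B} {g' : F ⟶ B} {g : B ⟶ C},
    Realizes δ f' f → Realizes δ' g' g →
    ∃ (G : 𝒞) (d : D ⟶ G) (e : G ⟶ F) (h' : G ⟶ A) (h : A ⟶ C) (δ'' : Ext E C G),
      f ≫ g = h ∧ h' ≫ f = e ≫ g' ∧ d ≫ h' = f' ∧ Realizes δ'' h' h ∧
      Realizes (pull E g' δ) d e ∧ push E e δ'' = δ' ∧ pull E g δ'' = push E d δ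

namespace ExtriangulatedStructure

section

variable {𝒞 : Type u} [Category.{v} 𝒞] [Preadditive 𝒞] [HasZeroObject 𝒞] [HasBinaryBiproducts 𝒞]
  (S : ExtriangulatedStructure.{w} 𝒞)

def Conflation {A B C : 𝒞} (x : A ⟶ B) (y : B ⟶ C) : Prop :=
  ∃ δ : Ext S.E C A, S.Realizes δ x y

def Inflation {A B : 𝒞} (x : A ⟶ B) : Prop :=
  ∃ (C : 𝒞) (y : B ⟶ C), S.Conflation x y

def Deflation {B C : 𝒞} (y : B ⟶ C) : Prop :=
  ∃ (A : 𝒞) (x : A ⟶ B), S.Conflation x y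

/-- Condition (WIC). -/
structure WIC : Prop where
  inflation : ∀ {X Y Z : 𝒞} (f : X ⟶ Y) (g : Y ⟶ Z), S.Inflation (f ≫ g) → S.Inflation f
  deflation : ∀ {X Y Z : 𝒞} (f : X ⟶ Y) (g : Y ⟶ Z), S.Deflation (f ≫ g) → S.Deflation g

def Projective (P : 𝒞) : Prop :=
  ∀ {A B C : 𝒞} (x : A ⟶ B) (y : B ⟶ C), S.Conflation x y →
    ∀ c : P ⟶ C, ∃ b : P ⟶ B, b ≫ y = c

def Injective (I : 𝒞) : Prop :=
  ∀ {A B C : 𝒞} (x : A ⟶ B) (y : B ⟶ C), S.Conflation x y →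
    ∀ a : A ⟶ I, ∃ b : B ⟶ I, x ≫ b = a

def EnoughProjectives : Prop :=
  ∀ M : 𝒞, ∃ (A P : 𝒞) (x : A ⟶ P) (y : P ⟶ M), S.Projective P ∧ S.Conflation x y

def EnoughInjectives : Prop :=
  ∀ M : 𝒞, ∃ (I C : 𝒞) (x : M ⟶ I) (y : I ⟶ C), S.Injective I ∧ S.Conflation x y

structure Frobenius : Prop where
  enoughProjectives : S.EnoughProjectives
  enoughInjectives : S.EnoughInjectives
  projective_iff_injective : ∀ X : 𝒞, S.Projective X ↔ S.Injective X

/-- `f` is compatible: if it is both an inflation and a deflation, it is an isomorphism. -/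
def Compatible {A B : 𝒞} (f : A ⟶ B) : Prop :=
  S.Inflation f → S.Deflation f → IsIso f

/-- Right exact sequences `A ⟶ B ⟶ C`. -/
def RightExactSeq {A B C : 𝒞} (f : A ⟶ B) (g : B ⟶ C) : Prop :=
  ∃ (K : 𝒞) (h₁ : A ⟶ K) (h₂ : K ⟶ B),
    S.Conflation h₂ g ∧ S.Deflation h₁ ∧ S.Compatible h₁ ∧ f = h₁ ≫ h₂

/-- Left exact sequences `A ⟶ B ⟶ C`. -/
def LeftExactSeq {A B C : 𝒞} (f : A ⟶ B) (g : B ⟶ C) : Prop :=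
  ∃ (K : 𝒞) (h₁ : B ⟶ K) (h₂ : K ⟶ C),
    S.Conflation f h₁ ∧ S.Inflation h₂ ∧ S.Compatible h₂ ∧ g = h₁ ≫ h₂

/-- Right exact 4-term `𝔼`-triangle sequences `A ⟶ B ⟶ C ⟶ D`. -/
def RightExactSeq₄ {A B C D : 𝒞} (f : A ⟶ B) (g : B ⟶ C) (h : C ⟶ D) : Prop :=
  ∃ (K : 𝒞) (g₁ : B ⟶ K) (g₂ : K ⟶ C),
    S.Conflation f g₁ ∧ S.Conflation g₂ h ∧ g = g₁ ≫ g₂ ∧ S.Compatible g₁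

/-- Left exact 4-term `𝔼`-triangle sequences `A ⟶ B ⟶ C ⟶ D`. -/
def LeftExactSeq₄ {A B C D : 𝒞} (f : A ⟶ B) (g : B ⟶ C) (h : C ⟶ D) : Prop :=
  ∃ (K : 𝒞) (g₁ : B ⟶ K) (g₂ : K ⟶ C),
    S.Conflation f g₁ ∧ S.Conflation g₂ h ∧ g = g₁ ≫ g₂ ∧ S.Compatible g₂

/-- `𝔼(𝒳, 𝒴) = 0`. -/
def ExtVanish (𝒳 𝒴 : ObjectProperty 𝒞) : Prop :=
  ∀ X Y : 𝒞, 𝒳 X → 𝒴 Y → ∀ δ : Ext S.E X Y, δ = 0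

/-- The right `𝔼`-orthogonal `𝒳^{⊥₁} = {M | 𝔼(𝒳, M) = 0}`. -/
def rightPerp (𝒳 : ObjectProperty 𝒞) : ObjectProperty 𝒞 :=
  fun M => ∀ X : 𝒞, 𝒳 X → ∀ δ : Ext S.E X M, δ = 0

/-- Cotorsion pairs of full subcategories closed under isomorphisms. -/
structure IsCotorsionPair (𝒯 ℱ : ObjectProperty 𝒞) : Prop where
  left_iso_closed : 𝒯.IsClosedUnderIsomorphisms
  right_iso_closed : ℱ.IsClosedUnderIsomorphisms
  ext_vanish : S.ExtVanish 𝒯 ℱ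
  exists_left : ∀ C : 𝒞, ∃ (F T : 𝒞) (x : F ⟶ T) (y : T ⟶ C), ℱ F ∧ 𝒯 T ∧ S.Conflation x y
  exists_right : ∀ C : 𝒞, ∃ (F T : 𝒞) (x : C ⟶ F) (y : F ⟶ T), ℱ F ∧ 𝒯 T ∧ S.Conflation x y

end

/-! ### Exact functors -/

section

variable {𝒞 : Type u₁} [Category.{v₁} 𝒞] [Preadditive 𝒞] [HasZeroObject 𝒞] [HasBinaryBiproducts 𝒞]
  {𝒟 : Type u₂} [Category.{v₂} 𝒟] [Preadditive 𝒟] [HasZeroObject 𝒟] [HasBinaryBiproducts 𝒟]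
  (S : ExtriangulatedStructure.{w₁} 𝒞) (S' : ExtriangulatedStructure.{w₂} 𝒟)

/-- Exact functors between extriangulated categories. -/
structure IsExactFunctor (F : 𝒞 ⥤ 𝒟) : Prop where
  additive : F.Additive
  compatible : ∀ {X Y : 𝒞} (f : X ⟶ Y), S.Compatible f → S'.Compatible (F.map f)
  exists_eta : ∃ η : ∀ C A : 𝒞, Ext S.E C A →+ Ext S'.E (F.obj C) (F.obj A),
    (∀ {C A A' : 𝒞} (a : A ⟶ A') (δ : Ext S.E C A),
      η C A' (push S.E a δ) = push S'.E (F.map a) (η C A δ)) ∧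
    (∀ {C C' A : 𝒞} (c : C' ⟶ C) (δ : Ext S.E C A),
      η C' A (pull S.E c δ) = pull S'.E (F.map c) (η C A δ)) ∧
    (∀ {A B C : 𝒞} (δ : Ext S.E C A) (x : A ⟶ B) (y : B ⟶ C), S.Realizes δ x y →
      S'.Realizes (η C A δ) (F.map x) (F.map y))

/-- Right exact functors. In the last field `K δ` is the object `A'` attached to the extension
`δ ∈ 𝔼(C, A)`, with its compatible deflation `p δ : F A ⟶ A'`; it depends on `δ` and not only
on `A`, so that naturality of `δ ↦ η δ ∈ 𝔼(F C, A')` is expressed for morphisms of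
extensions. -/
structure IsRightExactFunctor (F : 𝒞 ⥤ 𝒟) : Prop where
  additive : F.Additive
  compatible : ∀ {X Y : 𝒞} (f : X ⟶ Y), S.Compatible f → S'.Compatible (F.map f)
  rightExact : ∀ {A B C : 𝒞} (f : A ⟶ B) (g : B ⟶ C), S.RightExactSeq f g →
    S'.RightExactSeq (F.map f) (F.map g)
  exists_eta : ∃ (K : ∀ {C A : 𝒞}, Ext S.E C A → 𝒟)
    (p : ∀ {C A : 𝒞} (δ : Ext S.E C A), F.obj A ⟶ K δ)
    (η : ∀ {C A : 𝒞} (δ : Ext S.E C A), Ext S'.E (F.obj C) (K δ)),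
    (∀ {C A : 𝒞} (δ : Ext S.E C A), S'.Deflation (p δ) ∧ S'.Compatible (p δ)) ∧
    (∀ {A B C : 𝒞} (δ : Ext S.E C A) (f : A ⟶ B) (g : B ⟶ C), S.Realizes δ f g →
      ∃ x : K δ ⟶ F.obj B, F.map f = p δ ≫ x ∧ S'.Realizes (η δ) x (F.map g)) ∧
    (∀ {A C A' C' : 𝒞} (δ : Ext S.E C A) (δ' : Ext S.E C' A') (a : A ⟶ A') (c : C ⟶ C'),
      IsExtMor S.E δ δ' a c →
      ∃ k : K δ ⟶ K δ', p δ ≫ k = F.map a ≫ p δ' ∧ IsExtMor S'.E (η δ) (η δ') k (F.map c))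

/-- Left exact functors; this is the dual of `IsRightExactFunctor`. -/
structure IsLeftExactFunctor (F : 𝒞 ⥤ 𝒟) : Prop where
  additive : F.Additive
  compatible : ∀ {X Y : 𝒞} (f : X ⟶ Y), S.Compatible f → S'.Compatible (F.map f)
  leftExact : ∀ {A B C : 𝒞} (f : A ⟶ B) (g : B ⟶ C), S.LeftExactSeq f g →
    S'.LeftExactSeq (F.map f) (F.map g)
  exists_eta : ∃ (K : ∀ {C A : 𝒞}, Ext S.E C A → 𝒟)
    (q : ∀ {C A : 𝒞} (δ : Ext S.E C A), K δ ⟶ F.obj C)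
    (η : ∀ {C A : 𝒞} (δ : Ext S.E C A), Ext S'.E (K δ) (F.obj A)),
    (∀ {C A : 𝒞} (δ : Ext S.E C A), S'.Inflation (q δ) ∧ S'.Compatible (q δ)) ∧
    (∀ {A B C : 𝒞} (δ : Ext S.E C A) (f : A ⟶ B) (g : B ⟶ C), S.Realizes δ f g →
      ∃ y : F.obj B ⟶ K δ, F.map g = y ≫ q δ ∧ S'.Realizes (η δ) (F.map f) y) ∧
    (∀ {A C A' C' : 𝒞} (δ : Ext S.E C A) (δ' : Ext S.E C' A') (a : A ⟶ A') (c : C ⟶ C'),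
      IsExtMor S.E δ δ' a c →
      ∃ k : K δ ⟶ K δ', k ≫ q δ' = q δ ≫ F.map c ∧ IsExtMor S'.E (η δ) (η δ') (F.map a) k)

end

end ExtriangulatedStructure

/-! ### Recollements -/

/-- A recollement `(𝒜, ℬ, 𝒞)` of extriangulated categories. The functors `i^*, i_*, i^!` are
`iUp, iLow, iShriek`, and `j_!, j^*, j_*` are `jShriek, jUp, jLow`. -/
structure Recollement
    {𝒜 : Type u₁} [Category.{v₁} 𝒜] [Preadditive 𝒜] [HasZeroObject 𝒜] [HasBinaryBiproducts 𝒜]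
    {ℬ : Type u₂} [Category.{v₂} ℬ] [Preadditive ℬ] [HasZeroObject ℬ] [HasBinaryBiproducts ℬ]
    {𝒞 : Type u₃} [Category.{v₃} 𝒞] [Preadditive 𝒞] [HasZeroObject 𝒞] [HasBinaryBiproducts 𝒞]
    (SA : ExtriangulatedStructure.{w₁} 𝒜) (SB : ExtriangulatedStructure.{w₂} ℬ)
    (SC : ExtriangulatedStructure.{w₃} 𝒞) where
  iUp : ℬ ⥤ 𝒜
  iLow : 𝒜 ⥤ ℬ
  iShriek : ℬ ⥤ 𝒜
  jShriek : 𝒞 ⥤ ℬ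
  jUp : ℬ ⥤ 𝒞
  jLow : 𝒞 ⥤ ℬ
  iLow_exact : SA.IsExactFunctor SB iLow
  jUp_exact : SB.IsExactFunctor SC jUp
  iUp_rightExact : SB.IsRightExactFunctor SA iUp
  jShriek_rightExact : SC.IsRightExactFunctor SB jShriek
  iShriek_leftExact : SB.IsLeftExactFunctor SA iShriek
  jLow_leftExact : SC.IsLeftExactFunctor SB jLow
  /-- (R1) -/
  iUp_adj_iLow : iUp ⊣ iLow
  iLow_adj_iShriek : iLow ⊣ iShriek
  jShriek_adj_jUp : jShriek ⊣ jUp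
  jUp_adj_jLow : jUp ⊣ jLow
  /-- (R2) -/
  essImage_iff : ∀ X : ℬ, iLow.essImage X ↔ IsZero (jUp.obj X)
  /-- (R3) -/
  iLow_full : iLow.Full
  iLow_faithful : iLow.Faithful
  jShriek_full : jShriek.Full
  jShriek_faithful : jShriek.Faithful
  jLow_full : jLow.Full
  jLow_faithful : jLow.Faithful
  /-- (R4) -/
  exists_leftExact : ∀ X : ℬ, ∃ (A : 𝒜) (h : jLow.obj (jUp.obj X) ⟶ iLow.obj A),
    SB.LeftExactSeq₄ (iLow_adj_iShriek.counit.app X) (jUp_adj_jLow.unit.app X) h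
  /-- (R5) -/
  exists_rightExact : ∀ X : ℬ, ∃ (A' : 𝒜) (h : iLow.obj A' ⟶ jShriek.obj (jUp.obj X)),
    SB.RightExactSeq₄ h (jShriek_adj_jUp.counit.app X) (iUp_adj_iLow.unit.app X)

namespace Recollement

section

variable {𝒜 : Type u₁} [Category.{v₁} 𝒜] [Preadditive 𝒜] [HasZeroObject 𝒜] [HasBinaryBiproducts 𝒜]
  {ℬ : Type u₂} [Category.{v₂} ℬ] [Preadditive ℬ] [HasZeroObject ℬ] [HasBinaryBiproducts ℬ]
  {𝒞 : Type u₃} [Category.{v₃} 𝒞] [Preadditive 𝒞] [HasZeroObject 𝒞] [HasBinaryBiproducts 𝒞]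
  {SA : ExtriangulatedStructure.{w₁} 𝒜} {SB : ExtriangulatedStructure.{w₂} ℬ}
  {SC : ExtriangulatedStructure.{w₃} 𝒞}

/-- The left half `𝒯` of the glued pair. -/
def gluedLeft (R : Recollement SA SB SC) (𝒯₁ : ObjectProperty 𝒜) (𝒯₂ : ObjectProperty 𝒞) :
    ObjectProperty ℬ :=
  fun B => 𝒯₁ (R.iUp.obj B) ∧ 𝒯₂ (R.jUp.obj B)

/-- The right half `ℱ` of the glued pair. -/
def gluedRight (R : Recollement SA SB SC) (ℱ₁ : ObjectProperty 𝒜) (ℱ₂ : ObjectProperty 𝒞) :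
    ObjectProperty ℬ :=
  fun B => ℱ₁ (R.iShriek.obj B) ∧ ℱ₂ (R.jUp.obj B)

end

end Recollement

end Extri

/-!
Gluing and restriction of cotorsion pairs along a recollement `(𝒜, ℬ, 𝒞)` with `i^!` and `j_!`
exact.

Two facts carry everything. First, extensions vanish across adjunctions: if `F ⊣ G` and `G`
preserves conflations, then `𝔼(C, G Y) = 0` implies `𝔼(F C, Y) = 0`, since a lift of the unit
`C ⟶ G F C` to `G B` transposes to a section of `B ⟶ F C`
(`PreservesConflations.ext_leftAdjoint_eq_zero`, and dually `ext_rightAdjoint_eq_zero`); no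
comparison of extension groups is needed. Second, exactness of `i^!` turns (R4) into conflations
`i_* i^! X ⟶ X ⟶ j_* j^* X` (`Recollement.conflation_iShriek`), which by (WIC) and compatibility
force the left exact functor `j_*` to preserve conflations
(`Recollement.jLow_preservesConflations`).

For the glued pair, an object `M` is approximated on the right by pushing out `j_!` of an
approximation of `j^* M` along `j_! j^* M ⟶ M`, then `i_*` of an approximation of `i^! N` along
`i_* i^! N ⟶ N`, where `N` is the middle term obtained first; (ET4) assembles the two steps.
On the left, one pulls back along `M ⟶ j_* j^* M` and `N ⟶ i_* i^* N`. Here `i^*` is only right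
exact, but the deflation which it attaches to the second pull-back is also an inflation by (WIC),
hence an isomorphism (`IsRightExactFunctor.nonempty_iso_of_pull`). These constructions do not
use the vanishing `𝔼(𝒯, ℱ) = 0`, which is deduced from each of the conditions by placing an
object of `𝒯` or of `ℱ` in a conflation whose end terms are handled by the adjunctions. In the
Frobenius case `i_*` preserves injectives, so `i^*` preserves inflations and therefore
conflations, which reduces it to the case of exact `i^*`.

The restricted pairs are obtained by applying `i^!`, respectively `j^*`, to approximations of
`i_* A`, respectively `j_* C`; their orthogonality comes from the adjunctions.
-/

namespace Extri

open scoped ZeroObject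

/-! ### Functoriality of extensions -/

section Extensions

variable {𝒞 : Type u} [Category.{v} 𝒞] (E : 𝒞ᵒᵖ ⥤ 𝒞 ⥤ AddCommGrpCat.{w})

@[simp]
lemma push_id {C A : 𝒞} (δ : Ext E C A) : push E (𝟙 A) δ = δ := by
  simp [push]

@[simp]
lemma pull_id {C A : 𝒞} (δ : Ext E C A) : pull E (𝟙 C) δ = δ := by
  simp [pull]

lemma push_comp {C A A' A'' : 𝒞} (a : A ⟶ A') (a' : A' ⟶ A'') (δ : Ext E C A) :
    push E (a ≫ a') δ = push E a' (push E a δ) := by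
  simp [push]

lemma pull_comp {C C' C'' A : 𝒞} (c : C' ⟶ C) (c' : C'' ⟶ C') (δ : Ext E C A) :
    pull E (c' ≫ c) δ = pull E c' (pull E c δ) := by
  simp [pull]

lemma push_pull {C C' A A' : 𝒞} (a : A ⟶ A') (c : C' ⟶ C) (δ : Ext E C A) :
    push E a (pull E c δ) = pull E c (push E a δ) := by
  have h := congrArg AddCommGrpCat.Hom.hom ((E.map c.op).naturality a)
  exact (DFunLike.congr_fun h δ).symm

variable {E}

lemma push_injective {C A A' : 𝒞} (a : A ⟶ A') [IsIso a] :
    Function.Injective (push E (C := C) a) := fun δ δ' h => by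
  have := congrArg (push E (inv a)) h
  simpa [← push_comp] using this

lemma pull_injective {C C' A : 𝒞} (c : C' ⟶ C) [IsIso c] :
    Function.Injective (pull E (A := A) c) := fun δ δ' h => by
  have := congrArg (pull E (inv c)) h
  simpa [← pull_comp] using this

end Extensions

namespace ExtriangulatedStructure

section Exactness

variable {𝒞 : Type u} [Category.{v} 𝒞] [Preadditive 𝒞] [HasZeroObject 𝒞] [HasBinaryBiproducts 𝒞]
  {S : ExtriangulatedStructure.{w} 𝒞}

/-! ### Exactness of the Hom–`𝔼` sequences -/

section Realizes

variable {A B C : 𝒞} {δ : Ext S.E C A} {x : A ⟶ B} {y : B ⟶ C}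

lemma Realizes.conflation (h : S.Realizes δ x y) : S.Conflation x y := ⟨δ, h⟩

lemma Realizes.comp_eq_zero (h : S.Realizes δ x y) : x ≫ y = 0 := by
  obtain ⟨c, hc, -⟩ := S.et3 (S.realizes_zero A (0 : 𝒞)) h
    (a := 𝟙 A) (b := biprod.fst ≫ x) (by simp)
  have hc0 : c = 0 := (isZero_zero 𝒞).eq_of_src _ _
  have := congrArg (fun t => biprod.inl ≫ t) hc
  simpa [hc0] using this.symm

/-- `x` is a weak kernel of `y`. -/
lemma Realizes.exists_lift_of_comp_eq_zero (h : S.Realizes δ x y) {X : 𝒞} (f : X ⟶ B)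
    (hf : f ≫ y = 0) : ∃ a : X ⟶ A, a ≫ x = f := by
  obtain ⟨a, ha, -⟩ := S.et3_op (S.realizes_zero X (0 : 𝒞)) h
    (b := biprod.fst ≫ f) (c := 0) (by simp [hf])
  exact ⟨a, by simpa using ha.symm⟩

/-- `y` is a weak cokernel of `x`. -/
lemma Realizes.exists_desc_of_comp_eq_zero (h : S.Realizes δ x y) {X : 𝒞} (f : B ⟶ X)
    (hf : x ≫ f = 0) : ∃ c : C ⟶ X, y ≫ c = f := by
  obtain ⟨c, hc, -⟩ := S.et3 h (S.realizes_zero (0 : 𝒞) X)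
    (a := 0) (b := f ≫ biprod.inr) (by simp [reassoc_of% hf])
  exact ⟨c, by simpa using hc⟩

lemma Realizes.pull_self (h : S.Realizes δ x y) : pull S.E y δ = 0 := by
  obtain ⟨a, -, ha⟩ := S.et3_op (S.realizes_zero A B) h
    (b := biprod.desc x (𝟙 B)) (c := y) (by ext <;> simp [h.comp_eq_zero])
  simpa [IsExtMor] using ha.symm

lemma Realizes.push_self (h : S.Realizes δ x y) : push S.E x δ = 0 := by
  obtain ⟨c, -, hc⟩ := S.et3 h (S.realizes_zero B C)
    (a := x) (b := biprod.lift (𝟙 B) y) (by ext <;> simp [h.comp_eq_zero])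
  simpa [IsExtMor] using hc

lemma Realizes.exists_lift_of_pull_eq_zero (h : S.Realizes δ x y) {X : 𝒞} (c : X ⟶ C)
    (hc : pull S.E c δ = 0) : ∃ s : X ⟶ B, s ≫ y = c := by
  obtain ⟨b, -, hb⟩ := S.exists_middle (S.realizes_zero A X) h
    (a := 𝟙 A) (c := c) (by simp [IsExtMor, hc])
  exact ⟨biprod.inr ≫ b, by simp [← hb]⟩

lemma Realizes.exists_desc_of_push_eq_zero (h : S.Realizes δ x y) {X : 𝒞} (a : A ⟶ X)
    (ha : push S.E a δ = 0) : ∃ r : B ⟶ X, x ≫ r = a := by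
  obtain ⟨b, hb, -⟩ := S.exists_middle h (S.realizes_zero X C)
    (a := a) (c := 𝟙 C) (by simp [IsExtMor, ha])
  exact ⟨b ≫ biprod.fst, by simp [reassoc_of% hb]⟩

lemma Realizes.eq_zero_of_section (h : S.Realizes δ x y) (s : C ⟶ B) (hs : s ≫ y = 𝟙 C) :
    δ = 0 := by
  have := congrArg (pull S.E s) h.pull_self
  simpa [← pull_comp, hs] using this

lemma Realizes.eq_zero_of_retraction (h : S.Realizes δ x y) (r : B ⟶ A) (hr : x ≫ r = 𝟙 A) :
    δ = 0 := by
  have := congrArg (push S.E r) h.push_self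
  simpa [← push_comp, hr] using this

/-- Exactness of `Hom(A, F) ⟶ 𝔼(C, F) ⟶ 𝔼(B, F)`. -/
lemma Realizes.exists_push_of_pull_eq_zero (h : S.Realizes δ x y) {F : 𝒞} (ε : Ext S.E C F)
    (hε : pull S.E y ε = 0) : ∃ a : A ⟶ F, push S.E a δ = ε := by
  obtain ⟨D, x', y', h'⟩ := S.exists_realizes ε
  obtain ⟨b, hb⟩ := h'.exists_lift_of_pull_eq_zero y hε
  obtain ⟨a, -, ha⟩ := S.et3_op h h' (b := b) (c := 𝟙 C) (by simp [hb])
  exact ⟨a, by simpa [IsExtMor] using ha⟩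

lemma Realizes.isIso_right_of_isZero (h : S.Realizes δ x y) (hA : IsZero A) : IsIso y := by
  have hδ : δ = 0 := h.eq_zero_of_retraction 0 (hA.eq_of_src _ _)
  obtain ⟨s, hs⟩ := h.exists_lift_of_pull_eq_zero (𝟙 C) (by simp [hδ])
  refine ⟨s, ?_, hs⟩
  obtain ⟨a, ha⟩ := h.exists_lift_of_comp_eq_zero (y ≫ s - 𝟙 B) (by simp [hs])
  rw [hA.eq_of_tgt a 0, zero_comp] at ha
  exact (sub_eq_zero.mp ha.symm)

lemma Realizes.isIso_left_of_isZero (h : S.Realizes δ x y) (hC : IsZero C) : IsIso x := by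
  have hδ : δ = 0 := h.eq_zero_of_section 0 (hC.eq_of_src _ _)
  obtain ⟨r, hr⟩ := h.exists_desc_of_push_eq_zero (𝟙 A) (by simp [hδ])
  refine ⟨r, hr, ?_⟩
  obtain ⟨c, hc⟩ := h.exists_desc_of_comp_eq_zero (r ≫ x - 𝟙 B) (by simp [reassoc_of% hr])
  rw [hC.eq_of_src c 0, comp_zero] at hc
  exact (sub_eq_zero.mp hc.symm)

lemma Realizes.isZero_left (h : S.Realizes δ x y) [IsIso y] : IsZero A := by
  have hδ : δ = 0 := h.eq_zero_of_section (inv y) (by simp)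
  obtain ⟨r, hr⟩ := h.exists_desc_of_push_eq_zero (𝟙 A) (by simp [hδ])
  have hx : x = 0 := by
    rw [← cancel_mono y, h.comp_eq_zero, zero_comp]
  rw [IsZero.iff_id_eq_zero, ← hr, hx, zero_comp]

lemma Realizes.isZero_right (h : S.Realizes δ x y) [IsIso x] : IsZero C := by
  have hδ : δ = 0 := h.eq_zero_of_retraction (inv x) (by simp)
  obtain ⟨s, hs⟩ := h.exists_lift_of_pull_eq_zero (𝟙 C) (by simp [hδ])
  have hy : y = 0 := by
    rw [← cancel_epi x, h.comp_eq_zero, comp_zero]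
  rw [IsZero.iff_id_eq_zero, ← hs, hy, comp_zero]

/-- The five lemma for morphisms of extensions. -/
lemma Realizes.isIso_middle (h : S.Realizes δ x y) {A' B' C' : 𝒞} {δ' : Ext S.E C' A'}
    {x' : A' ⟶ B'} {y' : B' ⟶ C'} (h' : S.Realizes δ' x' y') {a : A ⟶ A'} {b : B ⟶ B'}
    {c : C ⟶ C'} [IsIso a] [IsIso c] (hac : IsExtMor S.E δ δ' a c) (hx : x ≫ b = a ≫ x')
    (hy : y ≫ c = b ≫ y') : IsIso b := by
  unfold IsExtMor at hac
  obtain ⟨s, hs⟩ := h.exists_lift_of_pull_eq_zero (y' ≫ inv c) (push_injective a (by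
    rw [push_pull, hac, ← pull_comp, Category.assoc, IsIso.inv_hom_id, Category.comp_id,
      h'.pull_self, map_zero]))
  obtain ⟨t, ht⟩ := h'.exists_lift_of_comp_eq_zero (𝟙 B' - s ≫ b) (by
    rw [Preadditive.sub_comp, Category.assoc, ← hy, reassoc_of% hs]; simp)
  -- `s` and `t` give a section of `b`, and dually `r` and `t'` give a retraction.
  have h₁ : (s + t ≫ inv a ≫ x) ≫ b = 𝟙 B' := by simp [hx, ht]
  obtain ⟨r, hr⟩ := h'.exists_desc_of_push_eq_zero (inv a ≫ x) (pull_injective c (by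
    rw [← push_pull, ← hac, ← push_comp, IsIso.hom_inv_id_assoc, h.push_self, map_zero]))
  obtain ⟨t', ht'⟩ := h.exists_desc_of_comp_eq_zero (𝟙 B - b ≫ r) (by
    rw [Preadditive.comp_sub, reassoc_of% hx, hr]; simp)
  have h₂ : b ≫ (r + y' ≫ inv c ≫ t') = 𝟙 B := by simp [← reassoc_of% hy, ht']
  have : s + t ≫ inv a ≫ x = r + y' ≫ inv c ≫ t' := by
    rw [← Category.comp_id (s + _), ← h₂, reassoc_of% h₁]
  exact ⟨_, h₂, by rw [← this, h₁]⟩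

lemma Realizes.exists_iso_middle (h : S.Realizes δ x y) {A' B' C' : 𝒞} {δ' : Ext S.E C' A'}
    {x' : A' ⟶ B'} {y' : B' ⟶ C'} (h' : S.Realizes δ' x' y') (a : A ⟶ A')
    (c : C ⟶ C') [IsIso a] [IsIso c] (hac : IsExtMor S.E δ δ' a c) :
    ∃ b : B ≅ B', x ≫ b.hom = a ≫ x' ∧ y ≫ c = b.hom ≫ y' := by
  obtain ⟨b, hx, hy⟩ := S.exists_middle h h' hac
  have := h.isIso_middle h' hac hx hy
  exact ⟨asIso b, hx, hy⟩

lemma Realizes.push_isIso (h : S.Realizes δ x y) {A' : 𝒞} (a : A ⟶ A') [IsIso a] :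
    S.Realizes (push S.E a δ) (inv a ≫ x) y := by
  obtain ⟨B', x', y', h'⟩ := S.exists_realizes (push S.E a δ)
  obtain ⟨b, hx, hy⟩ := h.exists_iso_middle h' a (𝟙 C) (by simp [IsExtMor])
  refine S.realizes_of_seqEquiv h' ⟨b.symm, ?_, ?_⟩
  · rw [IsIso.eq_inv_comp, ← reassoc_of% hx]; simp
  · rw [Iso.symm_hom, Iso.inv_comp_eq, ← hy, Category.comp_id]

lemma Realizes.pull_isIso (h : S.Realizes δ x y) {C' : 𝒞} (c : C' ⟶ C) [IsIso c] :
    S.Realizes (pull S.E c δ) x (y ≫ inv c) := by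
  obtain ⟨B', x', y', h'⟩ := S.exists_realizes (pull S.E c δ)
  obtain ⟨b, hx, hy⟩ := h'.exists_iso_middle h (𝟙 A) c (by simp [IsExtMor])
  refine S.realizes_of_seqEquiv h' ⟨b, ?_, ?_⟩
  · simpa using hx
  · rw [← reassoc_of% hy]; simp

end Realizes

lemma conflation_of_iso {A B C A' B' C' : 𝒞} {x : A ⟶ B} {y : B ⟶ C} (h : S.Conflation x y)
    {x' : A' ⟶ B'} {y' : B' ⟶ C'} (a : A ≅ A') (b : B ≅ B') (c : C ≅ C')
    (hx : x ≫ b.hom = a.hom ≫ x') (hy : y ≫ c.hom = b.hom ≫ y') : S.Conflation x' y' := by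
  obtain ⟨δ, h⟩ := h
  refine ⟨_, S.realizes_of_seqEquiv ((h.push_isIso a.hom).pull_isIso c.inv) ⟨b, ?_, ?_⟩⟩
  · simp [hx]
  · simp [hy]

lemma conflation_id_zero (A : 𝒞) {Z : 𝒞} (hZ : IsZero Z) :
    S.Conflation (𝟙 A) (0 : A ⟶ Z) :=
  conflation_of_iso ⟨_, S.realizes_zero A Z⟩ (Iso.refl A)
    ⟨biprod.fst, biprod.inl, by ext <;> simp [hZ.eq_of_src _ (0 : Z ⟶ A ⊞ Z)], by simp⟩
    (Iso.refl Z) (by simp) (hZ.eq_of_tgt _ _)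

lemma conflation_zero_id {Z : 𝒞} (hZ : IsZero Z) (C : 𝒞) :
    S.Conflation (0 : Z ⟶ C) (𝟙 C) :=
  conflation_of_iso ⟨_, S.realizes_zero Z C⟩ (Iso.refl Z)
    ⟨biprod.snd, biprod.inr, by ext <;> simp [hZ.eq_of_src _ (0 : Z ⟶ Z ⊞ C)], by simp⟩
    (Iso.refl C) (hZ.eq_of_src _ _) (by simp)

lemma inflation_of_isIso {A B : 𝒞} (f : A ⟶ B) [IsIso f] : S.Inflation f :=
  ⟨_, _, conflation_of_iso (conflation_id_zero A (isZero_zero 𝒞)) (Iso.refl A) (asIso f)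
    (Iso.refl _) (by simp) (by simp : _ = f ≫ (0 : B ⟶ _))⟩

/-- `𝔼(X, -)` vanishes on the middle term of a conflation if it vanishes on the end terms. -/
lemma ext_eq_zero_of_conflation_right {A B C X : 𝒞} {x : A ⟶ B} {y : B ⟶ C}
    (h : S.Conflation x y) (hA : ∀ δ : Ext S.E X A, δ = 0) (hC : ∀ δ : Ext S.E X C, δ = 0)
    (θ : Ext S.E X B) : θ = 0 := by
  obtain ⟨δ, h⟩ := h
  obtain ⟨D, u, v, hθ⟩ := S.exists_realizes θ
  obtain ⟨G, d, e, -, -, δ'', -, -, -, -, h₁, -, h₃⟩ := S.et4 h hθ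
  -- `y_* θ = 0` splits `C ⟶ G ⟶ X`, so `θ` is the image of a class in `𝔼(X, A)`.
  obtain ⟨s, hs⟩ := h₁.exists_lift_of_pull_eq_zero (𝟙 X) (by simp [hC])
  have := congrArg (pull S.E s) h₃
  rw [← push_pull, hA (pull S.E s δ''), map_zero, ← pull_comp, hs, pull_id] at this
  exact this.symm

/-- `𝔼(-, X)` vanishes on the middle term of a conflation if it vanishes on the end terms. -/
lemma ext_eq_zero_of_conflation_left {A B C X : 𝒞} {x : A ⟶ B} {y : B ⟶ C}
    (h : S.Conflation x y) (hA : ∀ δ : Ext S.E A X, δ = 0) (hC : ∀ δ : Ext S.E C X, δ = 0)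
    (θ : Ext S.E B X) : θ = 0 := by
  obtain ⟨δ, h⟩ := h
  obtain ⟨D, u, v, hθ⟩ := S.exists_realizes θ
  obtain ⟨G, d, e, -, -, δ'', -, -, -, -, h₁, -, h₃⟩ := S.et4_op hθ h
  -- `x^* θ = 0` splits `X ⟶ G ⟶ A`, so `θ` is the image of a class in `𝔼(C, X)`.
  obtain ⟨r, hr⟩ := h₁.exists_desc_of_push_eq_zero (𝟙 X) (by simp [hA])
  have := congrArg (push S.E r) h₃
  rw [push_pull, hC (push S.E r δ''), map_zero, ← push_comp, hr, push_id] at this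
  exact this.symm

end Exactness

section Functors

variable {𝒞 : Type u₁} [Category.{v₁} 𝒞] [Preadditive 𝒞] [HasZeroObject 𝒞] [HasBinaryBiproducts 𝒞]
  {𝒟 : Type u₂} [Category.{v₂} 𝒟] [Preadditive 𝒟] [HasZeroObject 𝒟] [HasBinaryBiproducts 𝒟]
  {S : ExtriangulatedStructure.{w₁} 𝒞} {S' : ExtriangulatedStructure.{w₂} 𝒟}

/-! ### Functors preserving conflations -/

variable (S S') in
/-- `F` sends conflations to conflations. This is weaker than exactness: no compatibility with
the functors `𝔼` is required. -/
def PreservesConflations (F : 𝒞 ⥤ 𝒟) : Prop :=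
  ∀ ⦃A B C : 𝒞⦄ (x : A ⟶ B) (y : B ⟶ C), S.Conflation x y → S'.Conflation (F.map x) (F.map y)

lemma IsExactFunctor.preservesConflations {F : 𝒞 ⥤ 𝒟} (hF : S.IsExactFunctor S' F) :
    S.PreservesConflations S' F := by
  obtain ⟨η, -, -, h⟩ := hF.exists_eta
  rintro A B C x y ⟨δ, hδ⟩
  exact ⟨_, h δ x y hδ⟩

/-- An exact functor inverting `a` identifies the middle terms of realizations of `δ`
and `a_* δ`. -/
lemma IsExactFunctor.nonempty_iso_of_push {F : 𝒞 ⥤ 𝒟} (hF : S.IsExactFunctor S' F)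
    {A B C A' B' : 𝒞} {δ : Ext S.E C A} {x : A ⟶ B} {y : B ⟶ C} (h : S.Realizes δ x y)
    (a : A ⟶ A') {x' : A' ⟶ B'} {y' : B' ⟶ C} (h' : S.Realizes (push S.E a δ) x' y')
    [IsIso (F.map a)] : Nonempty (F.obj B ≅ F.obj B') := by
  obtain ⟨η, h₁, -, h₃⟩ := hF.exists_eta
  obtain ⟨b, -⟩ := (h₃ _ _ _ h).exists_iso_middle (h₃ _ _ _ h') (F.map a) (𝟙 _)
    (by simp [IsExtMor, h₁])
  exact ⟨b⟩

/-- An exact functor inverting `c` identifies the middle terms of realizations of `δ`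
and `c^* δ`. -/
lemma IsExactFunctor.nonempty_iso_of_pull {F : 𝒞 ⥤ 𝒟} (hF : S.IsExactFunctor S' F)
    {A B C B' C' : 𝒞} {δ : Ext S.E C A} {x : A ⟶ B} {y : B ⟶ C} (h : S.Realizes δ x y)
    (c : C' ⟶ C) {x' : A ⟶ B'} {y' : B' ⟶ C'} (h' : S.Realizes (pull S.E c δ) x' y')
    [IsIso (F.map c)] : Nonempty (F.obj B' ≅ F.obj B) := by
  obtain ⟨η, -, h₂, h₃⟩ := hF.exists_eta
  obtain ⟨b, -⟩ := (h₃ _ _ _ h').exists_iso_middle (h₃ _ _ _ h) (𝟙 _) (F.map c)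
    (by simp [IsExtMor, h₂])
  exact ⟨b⟩

lemma PreservesConflations.isIso_map_right {F : 𝒞 ⥤ 𝒟} (hF : S.PreservesConflations S' F)
    {A B C : 𝒞} {x : A ⟶ B} {y : B ⟶ C} (h : S.Conflation x y) (hA : IsZero (F.obj A)) :
    IsIso (F.map y) :=
  (hF x y h).choose_spec.isIso_right_of_isZero hA

lemma PreservesConflations.isIso_map_left {F : 𝒞 ⥤ 𝒟} (hF : S.PreservesConflations S' F)
    {A B C : 𝒞} {x : A ⟶ B} {y : B ⟶ C} (h : S.Conflation x y) (hC : IsZero (F.obj C)) :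
    IsIso (F.map x) :=
  (hF x y h).choose_spec.isIso_left_of_isZero hC

/-- If `F ⊣ G` and `G` preserves conflations, then `𝔼(C, G Y) = 0` implies `𝔼(F C, Y) = 0`. -/
lemma PreservesConflations.ext_leftAdjoint_eq_zero {F : 𝒞 ⥤ 𝒟} {G : 𝒟 ⥤ 𝒞} (adj : F ⊣ G)
    (hG : S'.PreservesConflations S G) {C : 𝒞} {Y : 𝒟} (h : ∀ δ : Ext S.E C (G.obj Y), δ = 0)
    (δ : Ext S'.E (F.obj C) Y) : δ = 0 := by
  obtain ⟨B, x, y, hδ⟩ := S'.exists_realizes δ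
  obtain ⟨ε, hε⟩ := hG x y ⟨δ, hδ⟩
  -- The unit `C ⟶ G F C` lifts to `G B`; the transpose of the lift is a section of `B ⟶ F C`.
  obtain ⟨s, hs⟩ := hε.exists_lift_of_pull_eq_zero (adj.unit.app C) (h _)
  refine hδ.eq_zero_of_section ((adj.homEquiv _ _).symm s) ?_
  rw [← Adjunction.homEquiv_naturality_right_symm, hs]
  simp [Adjunction.homEquiv_counit]

/-- If `F ⊣ G` and `F` preserves conflations, then `𝔼(F C, Y) = 0` implies `𝔼(C, G Y) = 0`. -/
lemma PreservesConflations.ext_rightAdjoint_eq_zero {F : 𝒞 ⥤ 𝒟} {G : 𝒟 ⥤ 𝒞} (adj : F ⊣ G)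
    (hF : S.PreservesConflations S' F) {C : 𝒞} {Y : 𝒟} (h : ∀ δ : Ext S'.E (F.obj C) Y, δ = 0)
    (δ : Ext S.E C (G.obj Y)) : δ = 0 := by
  obtain ⟨B, x, y, hδ⟩ := S.exists_realizes δ
  obtain ⟨ε, hε⟩ := hF x y ⟨δ, hδ⟩
  obtain ⟨r, hr⟩ := hε.exists_desc_of_push_eq_zero (adj.counit.app Y) (h _)
  refine hδ.eq_zero_of_retraction (adj.homEquiv _ _ r) ?_
  rw [← Adjunction.homEquiv_naturality_left, hr]
  simp [Adjunction.homEquiv_unit]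

/-- A left adjoint of a functor preserving conflations preserves projective objects. -/
lemma PreservesConflations.projective_leftAdjoint {F : 𝒞 ⥤ 𝒟} {G : 𝒟 ⥤ 𝒞} (adj : F ⊣ G)
    (hG : S'.PreservesConflations S G) {P : 𝒞} (hP : S.Projective P) :
    S'.Projective (F.obj P) := by
  intro A B C x y hxy c
  obtain ⟨b, hb⟩ := hP _ _ (hG x y hxy) (adj.homEquiv _ _ c)
  refine ⟨(adj.homEquiv _ _).symm b, ?_⟩
  rw [← Adjunction.homEquiv_naturality_right_symm, hb, Equiv.symm_apply_apply]

/-! ### Right exact functors -/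

/-- A right exact functor killing the first term of a conflation inverts the deflation: the
attached deflation `0 ⟶ A'` is an inflation, hence an isomorphism by compatibility. -/
lemma IsRightExactFunctor.isIso_map_right {F : 𝒞 ⥤ 𝒟} (hF : S.IsRightExactFunctor S' F)
    {A B C : 𝒞} {x : A ⟶ B} {y : B ⟶ C} (h : S.Conflation x y) (hA : IsZero (F.obj A)) :
    IsIso (F.map y) := by
  obtain ⟨K, p, η, h₁, h₂, -⟩ := hF.exists_eta
  obtain ⟨δ, h⟩ := h
  obtain ⟨z, -, hz⟩ := h₂ δ x y h
  have : IsIso (p δ) := (h₁ δ).2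
    ⟨_, 𝟙 _, by rw [hA.eq_of_src (p δ) 0]; exact conflation_zero_id hA _⟩ (h₁ δ).1
  exact hz.isIso_right_of_isZero (hA.of_iso (asIso (p δ)).symm)

/-- Under (WIC), a compatible deflation that is the first factor of an inflation is invertible. -/
lemma isIso_of_deflation_of_inflation (hW : S.WIC) {A K B : 𝒞} {f : A ⟶ B} {p : A ⟶ K}
    {z : K ⟶ B} (hp : S.Deflation p) (hp' : S.Compatible p) (hf : f = p ≫ z)
    (hi : S.Inflation f) : IsIso p :=
  hp' (hW.inflation p z (hf ▸ hi)) hp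

/-- A right exact functor that sends inflations to inflations preserves conflations: the attached
deflations `F A ⟶ A'` are then invertible. -/
lemma IsRightExactFunctor.preservesConflations {F : 𝒞 ⥤ 𝒟} (hF : S.IsRightExactFunctor S' F)
    (hW : S'.WIC) (hi : ∀ {A B : 𝒞} (x : A ⟶ B), S.Inflation x → S'.Inflation (F.map x)) :
    S.PreservesConflations S' F := by
  obtain ⟨K, p, η, h₁, h₂, -⟩ := hF.exists_eta
  rintro A B C x y ⟨δ, h⟩
  obtain ⟨z, hxz, hz⟩ := h₂ δ x y h
  have := isIso_of_deflation_of_inflation hW (h₁ δ).1 (h₁ δ).2 hxz (hi x ⟨_, _, δ, h⟩)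
  exact conflation_of_iso ⟨_, hz⟩ (asIso (p δ)).symm (Iso.refl _) (Iso.refl _)
    (by simp [hxz]) (by simp)

/-- A right exact functor inverting `c` identifies the middle terms of realizations of `δ` and
`c^* δ`, provided it sends the inflation of `δ` to an inflation. -/
lemma IsRightExactFunctor.nonempty_iso_of_pull {F : 𝒞 ⥤ 𝒟} (hF : S.IsRightExactFunctor S' F)
    (hW : S'.WIC) {A B C B' C' : 𝒞} {δ : Ext S.E C A} {x : A ⟶ B} {y : B ⟶ C}
    (h : S.Realizes δ x y) (hi : S'.Inflation (F.map x)) (c : C' ⟶ C) {x' : A ⟶ B'}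
    {y' : B' ⟶ C'} (h' : S.Realizes (pull S.E c δ) x' y') [IsIso (F.map c)] :
    Nonempty (F.obj B' ≅ F.obj B) := by
  obtain ⟨K, p, η, h₁, h₂, h₃⟩ := hF.exists_eta
  obtain ⟨z, hxz, hz⟩ := h₂ _ _ _ h
  obtain ⟨z', -, hz'⟩ := h₂ _ _ _ h'
  have i₁ := isIso_of_deflation_of_inflation hW (h₁ δ).1 (h₁ δ).2 hxz hi
  obtain ⟨k, hk, hkc⟩ := h₃ (pull S.E c δ) δ (𝟙 A) c (by simp [IsExtMor])
  -- `p ≫ k` is invertible, so by (WIC) the compatible deflation `p` is also an inflation.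
  have hk' : p (pull S.E c δ) ≫ k = p δ := by simpa using hk
  have i₂ := isIso_of_deflation_of_inflation hW (h₁ (pull S.E c δ)).1 (h₁ _).2 hk'.symm
    (inflation_of_isIso _)
  have i₃ : IsIso k := by
    have : IsIso (p (pull S.E c δ) ≫ k) := hk' ▸ i₁
    exact IsIso.of_isIso_comp_left (p (pull S.E c δ)) k
  obtain ⟨b, -⟩ := hz'.exists_iso_middle hz k (F.map c) hkc
  exact ⟨b⟩

end Functors

end ExtriangulatedStructure

namespace Recollement

open ExtriangulatedStructure

variable {𝒜 : Type u₁} [Category.{v₁} 𝒜] [Preadditive 𝒜] [HasZeroObject 𝒜] [HasBinaryBiproducts 𝒜]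
  {ℬ : Type u₂} [Category.{v₂} ℬ] [Preadditive ℬ] [HasZeroObject ℬ] [HasBinaryBiproducts ℬ]
  {𝒞 : Type u₃} [Category.{v₃} 𝒞] [Preadditive 𝒞] [HasZeroObject 𝒞] [HasBinaryBiproducts 𝒞]
  {SA : ExtriangulatedStructure.{w₁} 𝒜} {SB : ExtriangulatedStructure.{w₂} ℬ}
  {SC : ExtriangulatedStructure.{w₃} 𝒞} (R : Recollement SA SB SC)

attribute [instance] Recollement.iLow_full Recollement.iLow_faithful Recollement.jShriek_full
  Recollement.jShriek_faithful Recollement.jLow_full Recollement.jLow_faithful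

/-! ### Formal properties of the six functors -/

lemma isZero_jUp_iLow (A : 𝒜) : IsZero (R.jUp.obj (R.iLow.obj A)) :=
  (R.essImage_iff _).1 (R.iLow.obj_mem_essImage A)

lemma isZero_iShriek_jLow (C : 𝒞) : IsZero (R.iShriek.obj (R.jLow.obj C)) := by
  rw [IsZero.iff_id_eq_zero]
  apply (R.iLow_adj_iShriek.homEquiv _ _).symm.injective
  apply (R.jUp_adj_jLow.homEquiv _ _).symm.injective
  exact (R.isZero_jUp_iLow _).eq_of_src _ _

lemma isZero_iUp_jShriek (C : 𝒞) : IsZero (R.iUp.obj (R.jShriek.obj C)) := by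
  rw [IsZero.iff_id_eq_zero]
  apply (R.iUp_adj_iLow.homEquiv _ _).injective
  apply (R.jShriek_adj_jUp.homEquiv _ _).injective
  exact (R.isZero_jUp_iLow _).eq_of_tgt _ _

instance isIso_iShriek_counit (X : ℬ) :
    IsIso (R.iShriek.map (R.iLow_adj_iShriek.counit.app X)) :=
  isIso_of_hom_comp_eq_id _ (R.iLow_adj_iShriek.right_triangle_components X)

instance isIso_iUp_unit (X : ℬ) : IsIso (R.iUp.map (R.iUp_adj_iLow.unit.app X)) :=
  isIso_of_comp_hom_eq_id _ (R.iUp_adj_iLow.left_triangle_components X)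

instance isIso_jUp_counit (X : ℬ) : IsIso (R.jUp.map (R.jShriek_adj_jUp.counit.app X)) :=
  isIso_of_hom_comp_eq_id _ (R.jShriek_adj_jUp.right_triangle_components X)

instance isIso_jUp_unit (X : ℬ) : IsIso (R.jUp.map (R.jUp_adj_jLow.unit.app X)) :=
  isIso_of_comp_hom_eq_id _ (R.jUp_adj_jLow.left_triangle_components X)

/-- `i^! i_* ≅ id`. -/
noncomputable def iLowIShriekIso (A : 𝒜) : R.iShriek.obj (R.iLow.obj A) ≅ A :=
  (asIso (R.iLow_adj_iShriek.unit.app A)).symm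

/-- `i^* i_* ≅ id`. -/
noncomputable def iLowIUpIso (A : 𝒜) : R.iUp.obj (R.iLow.obj A) ≅ A :=
  asIso (R.iUp_adj_iLow.counit.app A)

/-- `j^* j_! ≅ id`. -/
noncomputable def jShriekJUpIso (C : 𝒞) : R.jUp.obj (R.jShriek.obj C) ≅ C :=
  (asIso (R.jShriek_adj_jUp.unit.app C)).symm

/-- `j^* j_* ≅ id`. -/
noncomputable def jLowJUpIso (C : 𝒞) : R.jUp.obj (R.jLow.obj C) ≅ C :=
  asIso (R.jUp_adj_jLow.counit.app C)

/-! ### Conflations attached to an object -/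

/-- If `i^!` is exact, the left exact sequence of (R4) is a conflation: the error term `A` is
killed, because `i^!` sends the cokernel of `i_* i^! X ⟶ X` to zero. -/
lemma conflation_iShriek (hi : SB.PreservesConflations SA R.iShriek) (X : ℬ) :
    SB.Conflation (R.iLow_adj_iShriek.counit.app X) (R.jUp_adj_jLow.unit.app X) := by
  obtain ⟨A, h, K, g₁, g₂, h₁, h₂, hg, -⟩ := R.exists_leftExact X
  have hK : IsZero (R.iShriek.obj K) := (hi _ _ h₁).choose_spec.isZero_right
  have i₁ := hi.isIso_map_right h₂ hK
  have hA : IsZero A := ((R.isZero_iShriek_jLow _).of_iso (asIso (R.iShriek.map h)).symm).of_iso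
    (R.iLowIShriekIso A).symm
  have hA' : IsZero (R.iLow.obj A) := by
    have := R.iLow_exact.additive
    exact R.iLow.map_isZero hA
  have i₂ : IsIso g₂ := h₂.choose_spec.isIso_left_of_isZero hA'
  exact conflation_of_iso h₁ (Iso.refl _) (Iso.refl _) (asIso g₂) (by simp) (by simp [hg])

/-- If `i^*` preserves conflations, the right exact sequence of (R5) is a conflation. -/
lemma conflation_iUp (hi : SB.PreservesConflations SA R.iUp) (X : ℬ) :
    SB.Conflation (R.jShriek_adj_jUp.counit.app X) (R.iUp_adj_iLow.unit.app X) := by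
  obtain ⟨A, h, K, g₁, g₂, h₁, h₂, hg, -⟩ := R.exists_rightExact X
  have hK : IsZero (R.iUp.obj K) := (hi _ _ h₂).choose_spec.isZero_left
  have i₁ := hi.isIso_map_left h₁ hK
  have hA : IsZero A := ((R.isZero_iUp_jShriek _).of_iso (asIso (R.iUp.map h))).of_iso
    (R.iLowIUpIso A).symm
  have hA' : IsZero (R.iLow.obj A) := by
    have := R.iLow_exact.additive
    exact R.iLow.map_isZero hA
  have i₂ : IsIso g₁ := h₁.choose_spec.isIso_right_of_isZero hA'
  exact conflation_of_iso h₂ (asIso g₁).symm (Iso.refl _) (Iso.refl _) (by simp [hg]) (by simp)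

/-- If `i^!` preserves conflations, then so does `j_*`. -/
lemma jLow_preservesConflations (hW : SC.WIC) (hi : SB.PreservesConflations SA R.iShriek) :
    SC.PreservesConflations SB R.jLow := by
  obtain ⟨K, q, η, h₁, h₂, -⟩ := R.jLow_leftExact.exists_eta
  rintro A B C x y ⟨δ, h⟩
  obtain ⟨z, hyz, hz⟩ := h₂ δ x y h
  have hj := R.jUp_exact.preservesConflations
  -- `j^* q` is an inflation and, since `j^* j_* y` is a deflation, also a deflation.
  have i₁ : IsIso (R.jUp.map (q δ)) := by
    refine R.jUp_exact.compatible _ (h₁ δ).2 ?_ ?_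
    · obtain ⟨D, v, hv⟩ := (h₁ δ).1
      exact ⟨_, _, hj _ _ hv⟩
    · refine hW.deflation (R.jUp.map z) _ ?_
      rw [← R.jUp.map_comp, ← hyz]
      exact ⟨_, R.jUp.map (R.jLow.map x), conflation_of_iso ⟨δ, h⟩ (x' := R.jUp.map (R.jLow.map x))
        (y' := R.jUp.map (R.jLow.map y)) (R.jLowJUpIso A).symm
        (R.jLowJUpIso B).symm (R.jLowJUpIso C).symm
        (by simp [jLowJUpIso, IsIso.eq_inv_comp, ← Adjunction.counit_naturality_assoc])
        (by simp [jLowJUpIso, IsIso.eq_inv_comp, ← Adjunction.counit_naturality_assoc])⟩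
  -- Hence `q` is, up to isomorphism, the unit of `j^* ⊣ j_*` at `K δ`, which is a deflation.
  have i₂ : IsIso (q δ) := by
    refine (h₁ δ).2 (h₁ δ).1 ?_
    have hq : R.jUp_adj_jLow.unit.app (K δ) ≫ R.jLow.map (R.jUp.map (q δ)) =
        q δ ≫ R.jUp_adj_jLow.unit.app (R.jLow.obj C) :=
      (R.jUp_adj_jLow.unit.naturality (q δ)).symm
    exact ⟨_, _, conflation_of_iso (R.conflation_iShriek hi (K δ)) (Iso.refl _) (Iso.refl _)
      (asIso (R.jLow.map (R.jUp.map (q δ))) ≪≫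
        (asIso (R.jUp_adj_jLow.unit.app (R.jLow.obj C))).symm)
      (by simp; rfl) (by simp [reassoc_of% hq])⟩
  exact conflation_of_iso ⟨_, hz⟩ (Iso.refl _) (Iso.refl _) (asIso (q δ)) (by simp) (by simp [hyz])

/-! ### Approximations by the glued classes -/

section Glued

variable {𝒯₁ ℱ₁ : ObjectProperty 𝒜} {𝒯₂ ℱ₂ : ObjectProperty 𝒞}

/-- The conflation `M ⟶ F ⟶ T` is built in two steps: the middle term `N` of the push-out
along `j_! j^* M ⟶ M` of `j_!` of an approximation of `j^* M` corrects `j^*`, and the push-out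
along `i_* i^! N ⟶ N` of `i_*` of an approximation of `i^! N` corrects `i^!`. -/
lemma exists_conflation_gluedRight (hi : SB.IsExactFunctor SA R.iShriek)
    (hj : SC.IsExactFunctor SB R.jShriek) (h₁ : SA.IsCotorsionPair 𝒯₁ ℱ₁)
    (h₂ : SC.IsCotorsionPair 𝒯₂ ℱ₂) (M : ℬ) :
    ∃ (F T : ℬ) (x : M ⟶ F) (y : F ⟶ T), R.gluedRight ℱ₁ ℱ₂ F ∧ R.gluedLeft 𝒯₁ 𝒯₂ T ∧
      SB.Conflation x y := by
  have := h₁.left_iso_closed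
  have := h₁.right_iso_closed
  have := h₂.left_iso_closed
  have := h₂.right_iso_closed
  have hjc := R.jUp_exact.preservesConflations
  obtain ⟨F₂, T₂, x₂, y₂, hF₂, hT₂, hxy₂⟩ := h₂.exists_right (R.jUp.obj M)
  obtain ⟨ε, hε⟩ := hj.preservesConflations _ _ hxy₂
  obtain ⟨N, u, v, hN⟩ := SB.exists_realizes (push SB.E (R.jShriek_adj_jUp.counit.app M) ε)
  obtain ⟨eN⟩ := R.jUp_exact.nonempty_iso_of_push hε _ hN
  obtain ⟨F₁, T₁, x₁, y₁, hF₁, hT₁, hxy₁⟩ := h₁.exists_right (R.iShriek.obj N)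
  obtain ⟨ε', hε'⟩ := R.iLow_exact.preservesConflations _ _ hxy₁
  obtain ⟨F, u', v', hF⟩ := SB.exists_realizes (push SB.E (R.iLow_adj_iShriek.counit.app N) ε')
  obtain ⟨eF⟩ := hi.nonempty_iso_of_push hε' _ hF
  obtain ⟨T, d, e, h, h', δ, -, -, -, hT, hde, -, -⟩ := SB.et4 hN hF
  have i₁ := hjc.isIso_map_left ⟨_, hF⟩ (R.isZero_jUp_iLow T₁)
  have i₂ := hjc.isIso_map_left ⟨_, hde⟩ (R.isZero_jUp_iLow T₁)
  have i₃ := R.iUp_rightExact.isIso_map_right ⟨_, hde⟩ (R.isZero_iUp_jShriek T₂)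
  exact ⟨F, T, h, h', ⟨ℱ₁.prop_of_iso ((R.iLowIShriekIso F₁).symm ≪≫ eF) hF₁,
    ℱ₂.prop_of_iso ((R.jShriekJUpIso F₂).symm ≪≫ eN ≪≫ asIso (R.jUp.map u')) hF₂⟩,
    ⟨𝒯₁.prop_of_iso ((R.iLowIUpIso T₁).symm ≪≫ (asIso (R.iUp.map e)).symm) hT₁,
    𝒯₂.prop_of_iso ((R.jShriekJUpIso T₂).symm ≪≫ asIso (R.jUp.map d)) hT₂⟩, δ, hT⟩

/-- The conflation `F ⟶ T ⟶ M` is built by pulling back along `M ⟶ j_* j^* M` and then along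
`N ⟶ i_* i^* N`. Although `i^*` is only right exact, it preserves the conflation
`i_* F₁ ⟶ T ⟶ N`, because `i^* i_* F₁ ⟶ i^* i_* T₁` is an inflation. -/
lemma exists_conflation_gluedLeft (hWA : SA.WIC) (hWC : SC.WIC)
    (hi : SB.IsExactFunctor SA R.iShriek) (h₁ : SA.IsCotorsionPair 𝒯₁ ℱ₁)
    (h₂ : SC.IsCotorsionPair 𝒯₂ ℱ₂) (M : ℬ) :
    ∃ (F T : ℬ) (x : F ⟶ T) (y : T ⟶ M), R.gluedRight ℱ₁ ℱ₂ F ∧ R.gluedLeft 𝒯₁ 𝒯₂ T ∧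
      SB.Conflation x y := by
  have := h₁.left_iso_closed
  have := h₁.right_iso_closed
  have := h₂.left_iso_closed
  have := h₂.right_iso_closed
  have hic := hi.preservesConflations
  have hjc := R.jUp_exact.preservesConflations
  obtain ⟨F₂, T₂, x₂, y₂, hF₂, hT₂, hxy₂⟩ := h₂.exists_left (R.jUp.obj M)
  obtain ⟨ε, hε⟩ := R.jLow_preservesConflations hWC hic _ _ hxy₂
  obtain ⟨N, u, v, hN⟩ := SB.exists_realizes (pull SB.E (R.jUp_adj_jLow.unit.app M) ε)
  obtain ⟨eN⟩ := R.jUp_exact.nonempty_iso_of_pull hε _ hN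
  obtain ⟨F₁, T₁, x₁, y₁, hF₁, hT₁, δ₁, hxy₁⟩ := h₁.exists_left (R.iUp.obj N)
  obtain ⟨ε', hε'⟩ := R.iLow_exact.preservesConflations _ _ ⟨δ₁, hxy₁⟩
  obtain ⟨T, u', v', hT⟩ := SB.exists_realizes (pull SB.E (R.iUp_adj_iLow.unit.app N) ε')
  have hx₁ : SA.Inflation (R.iUp.map (R.iLow.map x₁)) :=
    hWA.inflation _ (R.iUp_adj_iLow.counit.app T₁)
      ⟨_, y₁, conflation_of_iso ⟨δ₁, hxy₁⟩ (R.iLowIUpIso F₁).symm (Iso.refl _) (Iso.refl _)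
        (by simp [iLowIUpIso]) (by simp)⟩
  obtain ⟨eT⟩ := R.iUp_rightExact.nonempty_iso_of_pull hWA hε' hx₁ _ hT
  obtain ⟨F, d, e, h', h, δ, -, -, -, hF, hde, -, -⟩ := SB.et4_op hT hN
  have i₁ := hjc.isIso_map_right ⟨_, hT⟩ (R.isZero_jUp_iLow F₁)
  have i₂ := hjc.isIso_map_right ⟨_, hde⟩ (R.isZero_jUp_iLow F₁)
  have i₃ := hic.isIso_map_left ⟨_, hde⟩ (R.isZero_iShriek_jLow F₂)
  exact ⟨F, T, h', h, ⟨ℱ₁.prop_of_iso ((R.iLowIShriekIso F₁).symm ≪≫ asIso (R.iShriek.map d)) hF₁,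
    ℱ₂.prop_of_iso ((R.jLowJUpIso F₂).symm ≪≫ (asIso (R.jUp.map e)).symm) hF₂⟩,
    ⟨𝒯₁.prop_of_iso ((R.iLowIUpIso T₁).symm ≪≫ eT.symm) hT₁,
    𝒯₂.prop_of_iso ((R.jLowJUpIso T₂).symm ≪≫ eN.symm ≪≫ (asIso (R.jUp.map v')).symm) hT₂⟩,
    δ, hF⟩

lemma isCotorsionPair_glued (hWA : SA.WIC) (hWC : SC.WIC) (hi : SB.IsExactFunctor SA R.iShriek)
    (hj : SC.IsExactFunctor SB R.jShriek) (h₁ : SA.IsCotorsionPair 𝒯₁ ℱ₁)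
    (h₂ : SC.IsCotorsionPair 𝒯₂ ℱ₂)
    (h : SB.ExtVanish (R.gluedLeft 𝒯₁ 𝒯₂) (R.gluedRight ℱ₁ ℱ₂)) :
    SB.IsCotorsionPair (R.gluedLeft 𝒯₁ 𝒯₂) (R.gluedRight ℱ₁ ℱ₂) where
  left_iso_closed :=
    have := h₁.left_iso_closed
    have := h₂.left_iso_closed
    ⟨fun e hX => ⟨𝒯₁.prop_of_iso (R.iUp.mapIso e) hX.1, 𝒯₂.prop_of_iso (R.jUp.mapIso e) hX.2⟩⟩
  right_iso_closed :=
    have := h₁.right_iso_closed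
    have := h₂.right_iso_closed
    ⟨fun e hX => ⟨ℱ₁.prop_of_iso (R.iShriek.mapIso e) hX.1, ℱ₂.prop_of_iso (R.jUp.mapIso e) hX.2⟩⟩
  ext_vanish := h
  exists_left := R.exists_conflation_gluedLeft hWA hWC hi h₁ h₂
  exists_right := R.exists_conflation_gluedRight hi hj h₁ h₂

/-! ### Vanishing of extensions between the glued classes -/

lemma ext_iLow_gluedRight (hi : SB.PreservesConflations SA R.iShriek)
    (h₁ : SA.ExtVanish 𝒯₁ ℱ₁) {A : 𝒜} {F : ℬ} (hA : 𝒯₁ A) (hF : R.gluedRight ℱ₁ ℱ₂ F)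
    (δ : Ext SB.E (R.iLow.obj A) F) : δ = 0 :=
  hi.ext_leftAdjoint_eq_zero R.iLow_adj_iShriek (h₁ _ _ hA hF.1) δ

lemma ext_jShriek_gluedRight (h₂ : SC.ExtVanish 𝒯₂ ℱ₂) {C : 𝒞} {F : ℬ} (hC : 𝒯₂ C)
    (hF : R.gluedRight ℱ₁ ℱ₂ F) (δ : Ext SB.E (R.jShriek.obj C) F) : δ = 0 :=
  R.jUp_exact.preservesConflations.ext_leftAdjoint_eq_zero R.jShriek_adj_jUp (h₂ _ _ hC hF.2) δ

lemma extVanish_glued_of_iUp (hi : SB.PreservesConflations SA R.iShriek)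
    (hi' : SB.PreservesConflations SA R.iUp) (h₁ : SA.ExtVanish 𝒯₁ ℱ₁)
    (h₂ : SC.ExtVanish 𝒯₂ ℱ₂) :
    SB.ExtVanish (R.gluedLeft 𝒯₁ 𝒯₂) (R.gluedRight ℱ₁ ℱ₂) := fun X _ hX hF =>
  ext_eq_zero_of_conflation_left (R.conflation_iUp hi' X) (R.ext_jShriek_gluedRight h₂ hX.2 hF)
    (R.ext_iLow_gluedRight hi h₁ hX.1 hF)

/-- The conflations `i_* A' ⟶ j_! j^* X ⟶ K` and `K ⟶ X ⟶ i_* i^* X` of (R5) reduce the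
vanishing of `𝔼(X, F)` to that of `𝔼(K, F)`, which is a cokernel of
`Hom(j_! j^* X, F) ⟶ Hom(i_* A', F)`. -/
lemma extVanish_glued_of_surjective (hi : SB.PreservesConflations SA R.iShriek)
    (h₁ : SA.ExtVanish 𝒯₁ ℱ₁) (h₂ : SC.ExtVanish 𝒯₂ ℱ₂)
    (hs : ∀ (A : 𝒜) (T : 𝒞), 𝒯₂ T → ∀ f : R.iLow.obj A ⟶ R.jShriek.obj T,
      ∀ F : ℬ, R.gluedRight ℱ₁ ℱ₂ F →
        Function.Surjective (fun g : R.jShriek.obj T ⟶ F => f ≫ g)) :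
    SB.ExtVanish (R.gluedLeft 𝒯₁ 𝒯₂) (R.gluedRight ℱ₁ ℱ₂) := by
  intro X F hX hF
  obtain ⟨A, h, K, g₁, g₂, ⟨ε, hε⟩, hK, -, -⟩ := R.exists_rightExact X
  refine ext_eq_zero_of_conflation_left hK (fun δ => ?_) (R.ext_iLow_gluedRight hi h₁ hX.1 hF)
  obtain ⟨a, rfl⟩ := hε.exists_push_of_pull_eq_zero δ (R.ext_jShriek_gluedRight h₂ hX.2 hF _)
  obtain ⟨g, rfl⟩ := hs _ _ hX.2 h F hF a
  rw [push_comp, hε.push_self, map_zero]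

lemma extVanish_glued_of_le_map (h₂ : SC.ExtVanish 𝒯₂ ℱ₂)
    (hT : R.gluedLeft 𝒯₁ 𝒯₂ ≤ 𝒯₂.map R.jShriek) :
    SB.ExtVanish (R.gluedLeft 𝒯₁ 𝒯₂) (R.gluedRight ℱ₁ ℱ₂) := by
  intro X F hX hF δ
  obtain ⟨T, hT, ⟨e⟩⟩ := hT X hX
  apply pull_injective e.hom
  rw [map_zero]
  exact R.ext_jShriek_gluedRight h₂ hT hF _

lemma extVanish_glued_of_le_rightPerp (hi : SB.PreservesConflations SA R.iShriek)
    (h₂ : SC.ExtVanish 𝒯₂ ℱ₂) (hF₁ : ℱ₁.map R.iLow ≤ SB.rightPerp (R.gluedLeft 𝒯₁ 𝒯₂)) :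
    SB.ExtVanish (R.gluedLeft 𝒯₁ 𝒯₂) (R.gluedRight ℱ₁ ℱ₂) := fun X F hX hF =>
  ext_eq_zero_of_conflation_right (R.conflation_iShriek hi F)
    (hF₁ _ (ℱ₁.prop_map_obj R.iLow hF.1) X hX)
    (R.jUp_exact.preservesConflations.ext_rightAdjoint_eq_zero R.jUp_adj_jLow
      (h₂ _ _ hX.2 hF.2))

/-- In the Frobenius case `i_*` preserves injectives, because it preserves projectives; hence
`i^*` preserves inflations, and so conflations. -/
lemma iUp_preservesConflations_of_frobenius (hWA : SA.WIC)
    (hi : SB.PreservesConflations SA R.iShriek) (hA : SA.Frobenius) (hB : SB.Frobenius) :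
    SB.PreservesConflations SA R.iUp := by
  refine R.iUp_rightExact.preservesConflations hWA ?_
  rintro X Y x ⟨Z, y, hxy⟩
  obtain ⟨I, J, a, b, hI, hab⟩ := hA.enoughInjectives (R.iUp.obj X)
  have hI' : SB.Injective (R.iLow.obj I) := (hB.projective_iff_injective _).1
    (hi.projective_leftAdjoint R.iLow_adj_iShriek ((hA.projective_iff_injective I).2 hI))
  obtain ⟨t, ht⟩ := hI' x y hxy (R.iUp_adj_iLow.homEquiv _ _ a)
  refine hWA.inflation _ ((R.iUp_adj_iLow.homEquiv _ _).symm t) ?_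
  rw [← Adjunction.homEquiv_naturality_left_symm, ht, Equiv.symm_apply_apply]
  exact ⟨J, b, hab⟩

end Glued

/-! ### Restriction of cotorsion pairs -/

section Restriction

variable {𝒰 𝒱 : ObjectProperty ℬ}

lemma isCotorsionPair_iUp_iShriek (hi : SB.PreservesConflations SA R.iShriek)
    (h : SB.IsCotorsionPair 𝒰 𝒱) (h₁ : (𝒰.map R.iShriek).map R.iLow ≤ 𝒰)
    (h₂ : (𝒰.map R.iUp).map R.iLow ≤ 𝒰) :
    SA.IsCotorsionPair (𝒰.map R.iUp) (𝒱.map R.iShriek) where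
  left_iso_closed := inferInstance
  right_iso_closed := inferInstance
  ext_vanish := by
    rintro A A' hA ⟨V, hV, ⟨e⟩⟩ δ
    apply push_injective e.inv
    rw [map_zero]
    exact R.iLow_exact.preservesConflations.ext_rightAdjoint_eq_zero R.iLow_adj_iShriek
      (h.ext_vanish _ _ (h₂ _ (ObjectProperty.prop_map_obj _ _ hA)) hV) _
  exists_left := by
    intro A
    obtain ⟨V, U, x, y, hV, hU, hxy⟩ := h.exists_left (R.iLow.obj A)
    refine ⟨_, _, _, R.iShriek.map y ≫ (R.iLowIShriekIso A).hom, 𝒱.prop_map_obj _ hV,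
      ⟨_, h₁ _ (ObjectProperty.prop_map_obj _ _ (𝒰.prop_map_obj _ hU)),
        ⟨R.iLowIUpIso _⟩⟩,
      conflation_of_iso (hi _ _ hxy) (Iso.refl _) (Iso.refl _) (R.iLowIShriekIso A)
        (x' := R.iShriek.map x) (by simp) (by simp)⟩
  exists_right := by
    intro A
    obtain ⟨V, U, x, y, hV, hU, hxy⟩ := h.exists_right (R.iLow.obj A)
    refine ⟨_, _, (R.iLowIShriekIso A).inv ≫ R.iShriek.map x, _, 𝒱.prop_map_obj _ hV,
      ⟨_, h₁ _ (ObjectProperty.prop_map_obj _ _ (𝒰.prop_map_obj _ hU)),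
        ⟨R.iLowIUpIso _⟩⟩,
      conflation_of_iso (hi _ _ hxy) (R.iLowIShriekIso A) (Iso.refl _) (Iso.refl _)
        (y' := R.iShriek.map y) (by simp) (by simp)⟩

lemma extVanish_jUp_of_jLow (hj : SC.PreservesConflations SB R.jLow)
    (h : SB.ExtVanish 𝒰 𝒱) (hV : (𝒱.map R.jUp).map R.jLow ≤ 𝒱) :
    SC.ExtVanish (𝒰.map R.jUp) (𝒱.map R.jUp) := by
  rintro C C' ⟨U, hU, ⟨e⟩⟩ hC' δ
  apply pull_injective e.hom
  rw [map_zero]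
  exact hj.ext_leftAdjoint_eq_zero R.jUp_adj_jLow
    (h _ _ hU (hV _ (ObjectProperty.prop_map_obj _ _ hC'))) _

lemma extVanish_jUp_of_jShriek (hj : SC.PreservesConflations SB R.jShriek)
    (h : SB.ExtVanish 𝒰 𝒱) (hU : (𝒰.map R.jUp).map R.jShriek ≤ 𝒰) :
    SC.ExtVanish (𝒰.map R.jUp) (𝒱.map R.jUp) := by
  rintro C C' hC ⟨V, hV, ⟨e⟩⟩ δ
  apply push_injective e.inv
  rw [map_zero]
  exact hj.ext_rightAdjoint_eq_zero R.jShriek_adj_jUp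
    (h _ _ (hU _ (ObjectProperty.prop_map_obj _ _ hC)) hV) _

lemma isCotorsionPair_jUp (h : SB.IsCotorsionPair 𝒰 𝒱)
    (h₀ : SC.ExtVanish (𝒰.map R.jUp) (𝒱.map R.jUp)) :
    SC.IsCotorsionPair (𝒰.map R.jUp) (𝒱.map R.jUp) where
  left_iso_closed := inferInstance
  right_iso_closed := inferInstance
  ext_vanish := h₀
  exists_left := by
    intro C
    obtain ⟨V, U, x, y, hV, hU, hxy⟩ := h.exists_left (R.jLow.obj C)
    exact ⟨_, _, _, R.jUp.map y ≫ (R.jLowJUpIso C).hom, 𝒱.prop_map_obj _ hV,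
      𝒰.prop_map_obj _ hU, conflation_of_iso (R.jUp_exact.preservesConflations _ _ hxy)
        (Iso.refl _) (Iso.refl _) (R.jLowJUpIso C) (x' := R.jUp.map x) (by simp) (by simp)⟩
  exists_right := by
    intro C
    obtain ⟨V, U, x, y, hV, hU, hxy⟩ := h.exists_right (R.jLow.obj C)
    exact ⟨_, _, (R.jLowJUpIso C).inv ≫ R.jUp.map x, _, 𝒱.prop_map_obj _ hV,
      𝒰.prop_map_obj _ hU, conflation_of_iso (R.jUp_exact.preservesConflations _ _ hxy)
        (R.jLowJUpIso C) (Iso.refl _) (Iso.refl _) (y' := R.jUp.map y) (by simp) (by simp)⟩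

end Restriction

end Recollement

end Extri

theorem mainTheorem1
    {𝒜 : Type u₁} [Category.{v₁} 𝒜] [Preadditive 𝒜] [HasZeroObject 𝒜] [HasBinaryBiproducts 𝒜]
    {ℬ : Type u₂} [Category.{v₂} ℬ] [Preadditive ℬ] [HasZeroObject ℬ] [HasBinaryBiproducts ℬ]
    {𝒞 : Type u₃} [Category.{v₃} 𝒞] [Preadditive 𝒞] [HasZeroObject 𝒞] [HasBinaryBiproducts 𝒞]
    (SA : Extri.ExtriangulatedStructure.{w₁} 𝒜)
    (SB : Extri.ExtriangulatedStructure.{w₂} ℬ)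
    (SC : Extri.ExtriangulatedStructure.{w₃} 𝒞)
    (wicA : SA.WIC) (wicB : SB.WIC) (wicC : SC.WIC)
    (R : Extri.Recollement SA SB SC)
    (enoughProj : SB.EnoughProjectives)
    (iShriek_exact : SB.IsExactFunctor SA R.iShriek)
    (jShriek_exact : SC.IsExactFunctor SB R.jShriek) :
    -- (1)
    (∀ (𝒯₁ ℱ₁ : ObjectProperty 𝒜) (𝒯₂ ℱ₂ : ObjectProperty 𝒞),
      SA.IsCotorsionPair 𝒯₁ ℱ₁ → SC.IsCotorsionPair 𝒯₂ ℱ₂ →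
      ( -- (i)
        SB.ExtVanish (R.gluedLeft 𝒯₁ 𝒯₂) (R.gluedRight ℱ₁ ℱ₂) ∨
        -- (ii)
        SB.IsExactFunctor SA R.iUp ∨
        -- (iii)
        (∀ (A : 𝒜) (T : 𝒞), 𝒯₂ T → ∀ f : R.iLow.obj A ⟶ R.jShriek.obj T,
          ∀ F : ℬ, R.gluedRight ℱ₁ ℱ₂ F →
            Function.Surjective (fun g : R.jShriek.obj T ⟶ F => f ≫ g)) ∨
        -- (iv)
        (R.gluedLeft 𝒯₁ 𝒯₂ ≤ 𝒯₂.map R.jShriek ∨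
          ℱ₁.map R.iLow ≤ SB.rightPerp (R.gluedLeft 𝒯₁ 𝒯₂)) ∨
        -- (v)
        (SA.Frobenius ∧ SB.Frobenius)) →
      SB.IsCotorsionPair (R.gluedLeft 𝒯₁ 𝒯₂) (R.gluedRight ℱ₁ ℱ₂)) ∧
    -- (2)
    (∀ 𝒰 𝒱 : ObjectProperty ℬ, SB.IsCotorsionPair 𝒰 𝒱 →
      (𝒰.map R.iShriek).map R.iLow ≤ 𝒰 → (𝒰.map R.iUp).map R.iLow ≤ 𝒰 →
      SA.IsCotorsionPair (𝒰.map R.iUp) (𝒱.map R.iShriek)) ∧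
    -- (3)
    (∀ 𝒰 𝒱 : ObjectProperty ℬ, SB.IsCotorsionPair 𝒰 𝒱 →
      ((𝒱.map R.jUp).map R.jLow ≤ 𝒱 ∨ (𝒰.map R.jUp).map R.jShriek ≤ 𝒰) →
      SC.IsCotorsionPair (𝒰.map R.jUp) (𝒱.map R.jUp)) := by
  have hi := iShriek_exact.preservesConflations
  refine ⟨fun 𝒯₁ ℱ₁ 𝒯₂ ℱ₂ h₁ h₂ h => ?_, fun 𝒰 𝒱 h hU hU' => ?_, fun 𝒰 𝒱 h h' => ?_⟩
  · refine R.isCotorsionPair_glued wicA wicC iShriek_exact jShriek_exact h₁ h₂ ?_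
    have e₁ := h₁.ext_vanish
    have e₂ := h₂.ext_vanish
    obtain h | h | h | (h | h) | ⟨hA, hB⟩ := h
    · exact h
    · exact R.extVanish_glued_of_iUp hi h.preservesConflations e₁ e₂
    · exact R.extVanish_glued_of_surjective hi e₁ e₂ h
    · exact R.extVanish_glued_of_le_map e₂ h
    · exact R.extVanish_glued_of_le_rightPerp hi e₂ h
    · exact R.extVanish_glued_of_iUp hi (R.iUp_preservesConflations_of_frobenius wicA hi hA hB)
        e₁ e₂
  · exact R.isCotorsionPair_iUp_iShriek hi h hU hU'
  · obtain h' | h' := h'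
    · exact R.isCotorsionPair_jUp h (R.extVanish_jUp_of_jLow
        (R.jLow_preservesConflations wicC hi) h.ext_vanish h')
    · exact R.isCotorsionPair_jUp h
        (R.extVanish_jUp_of_jShriek jShriek_exact.preservesConflations h.ext_vanish h')
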